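/- Let $\mathcal H=\mathbb C^d$ with computational basis $\{|s\rangle\}$ (for $n$ qubits, $d=2^n$). Let $\mathcal U$ be a unitary 3-design on $\mathcal H$, that is, a probability distribution on the unitary group such that $\mathbb E_{U\sim\mathcal U}\,U^{\otimes 3}XU^{\dagger\otimes 3}=\mathbb E_{U\sim\mathrm{Haar}}\,U^{\otimes 3}XU^{\dagger\otimes 3}$ for every operator $X$ on $\mathcal H^{\otimes 3}$. Let $O$ be a traceless Hermitian operator and $\rho$ a density operator on $\mathcal H$. Then the measurement channel $$\mathcal M(A)=\mathbb E_{U\sim\mathcal U}\sum_s\langle s|UAU^\dagger|s\rangle\,U^\dagger|s\rangle\langle s|U$$ is invertible. Let $\mathbb V(O,\rho)$ be the variance in standard shadow estimation, that is, the variance of the single-round estimator $\operatorname{Tr}[O\,\mathcal M^{-1}(U^\dagger|s\rangle\langle s|U)]$, where $U$ is drawn from $\mathcal U$ and then the outcome $s$ is drawn with probability $\langle s|U\rho U^\dagger|s\rangle$. Then $$\mathbb V(O,\rho)=\frac{d+1}{d+2}\left[\operatorname{Tr}(O^2)+2\operatorname{Tr}(\rho O^2)\right]-[\operatorname{Tr}(\rho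 O)]^2\;\le\;2\|O\|_2^2 ,$$ where $\|O\|_2=\sqrt{\operatorname{Tr}(O^\dagger O)}$ is the Schatten 2-norm. Moreover, for every Hermitian operator $Q$ and the density operator $\rho$, $$\operatorname{Tr}(Q^2)+[\operatorname{Tr}(\rho Q)]^2\ge 2\operatorname{Tr}(\rho Q^2).$$ -/

import Mathlib

open MeasureTheory
open scoped Matrix ComplexOrder

noncomputable section

namespace ShadowEstimation

/-- The unitary group of the `d`-dimensional Hilbert space `ℂ^d`, written in the
computational basis `|0⟩, …, |d-1⟩`. For `n` qubits, `d = 2 ^ n`. -/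
abbrev UGroup (d : ℕ) : Type := Matrix.unitaryGroup (Fin d) ℂ

instance instMeasurableSpaceUGroup (d : ℕ) : MeasurableSpace (UGroup d) := borel _

instance instBorelSpaceUGroup (d : ℕ) : BorelSpace (UGroup d) := ⟨rfl⟩

instance instCompactSpaceUGroup (d : ℕ) : CompactSpace (UGroup d) := by
  have hK : IsCompact (Set.univ.pi fun _ : Fin d => Set.univ.pi fun _ : Fin d =>
      Metric.closedBall (0 : ℂ) 1) :=
    isCompact_univ_pi fun _ => isCompact_univ_pi fun _ => isCompact_closedBall _ _
  have hcl : IsClosed {A : Matrix (Fin d) (Fin d) ℂ | A * star A = 1} :=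
    isClosed_eq (by fun_prop) continuous_const
  have hset : (Matrix.unitaryGroup (Fin d) ℂ : Set (Matrix (Fin d) (Fin d) ℂ)) =
      {A | A * star A = 1} := by
    ext A
    exact Matrix.mem_unitaryGroup_iff
  rw [← hset] at hcl
  refine isCompact_iff_compactSpace.mp (hK.of_isClosed_subset hcl ?_)
  intro A hA i _ j _
  simpa using entry_norm_bound_of_unitary hA i j

/-- The normalized Haar measure of the unitary group (total mass `1`). -/
def haarUnitary (d : ℕ) : Measure (UGroup d) := Measure.haarMeasure ⊤

/-- The tensor power `A^{⊗ t}` as a matrix on `(ℂ^d)^{⊗ t}`, whose computational basis is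
indexed by `Fin t → Fin d`. -/
def tensorPow {d : ℕ} (t : ℕ) (A : Matrix (Fin d) (Fin d) ℂ) :
    Matrix (Fin t → Fin d) (Fin t → Fin d) ℂ :=
  Matrix.of fun i j => ∏ k, A (i k) (j k)

/-- A random unitary ensemble (a Borel probability law on the unitary group) is a
*unitary `t`-design* if its `t`-fold twirl agrees with the Haar twirl:
`E_{U ∼ 𝒰} U^{⊗ t} X U^{† ⊗ t} = E_{U ∼ Haar} U^{⊗ t} X U^{† ⊗ t}` for every operator `X`
on `(ℂ^d)^{⊗ t}`. Expectations of matrices are taken entry by entry. -/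
def IsUnitaryDesign {d : ℕ} (t : ℕ) (𝒰 : Measure (UGroup d)) : Prop :=
  ∀ (X : Matrix (Fin t → Fin d) (Fin t → Fin d) ℂ) (i j : Fin t → Fin d),
    ∫ U, (tensorPow t U.1 * X * (tensorPow t U.1)ᴴ) i j ∂𝒰 =
      ∫ U, (tensorPow t U.1 * X * (tensorPow t U.1)ᴴ) i j ∂(haarUnitary d)

/-- Density operators on `ℂ^d`. -/
structure IsDensity {d : ℕ} (ρ : Matrix (Fin d) (Fin d) ℂ) : Prop where
  posSemidef : ρ.PosSemidef
  trace_eq_one : ρ.trace = 1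

/-- The rotated basis projector `U† |s⟩⟨s| U`. -/
def snapshot {d : ℕ} (U : UGroup d) (s : Fin d) : Matrix (Fin d) (Fin d) ℂ :=
  U.1ᴴ * Matrix.single s s 1 * U.1

/-- The measurement channel `𝓜(A) = E_{U ∼ 𝒰} ∑ s, ⟨s|U A U†|s⟩ U† |s⟩⟨s| U`. -/
def measurementChannel {d : ℕ} (𝒰 : Measure (UGroup d)) (A : Matrix (Fin d) (Fin d) ℂ) :
    Matrix (Fin d) (Fin d) ℂ :=
  Matrix.of fun i j => ∫ U, ∑ s, (U.1 * A * U.1ᴴ) s s * snapshot U s i j ∂𝒰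

/-- The reconstruction map `𝓜⁻¹`. It is the two-sided inverse of the measurement channel
whenever the latter is bijective. -/
def reconstructionMap {d : ℕ} (𝒰 : Measure (UGroup d)) :
    Matrix (Fin d) (Fin d) ℂ → Matrix (Fin d) (Fin d) ℂ :=
  Function.invFun (measurementChannel 𝒰)

/-- The Born probability `P_ρ(s | U) = ⟨s|U ρ U†|s⟩`, a nonnegative real number for a
density operator `ρ`. -/
def bornProb {d : ℕ} (ρ : Matrix (Fin d) (Fin d) ℂ) (U : UGroup d) (s : Fin d) : ℝ :=
  ((U.1 * ρ * U.1ᴴ) s s).re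

/-- The joint law of `(U, s)` in one round of standard shadow estimation: `U` is sampled
from `𝒰`, then, given `U`, the outcome `s` is sampled with probability `P_ρ(s | U)`. -/
def roundLaw {d : ℕ} (𝒰 : Measure (UGroup d)) (ρ : Matrix (Fin d) (Fin d) ℂ) :
    Measure (UGroup d × Fin d) :=
  ∑ s, (𝒰.withDensity fun U => ENNReal.ofReal (bornProb ρ U s)).map fun U => (U, s)

/-- The single-round estimator `Tr[O 𝓜⁻¹(U† |s⟩⟨s| U)]` of `Tr(O ρ)`. The trace is a real
number for an observable `O`, since `𝓜` and `𝓜⁻¹` preserve Hermitian operators. -/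
def shadowEstimator {d : ℕ} (𝒰 : Measure (UGroup d)) (O : Matrix (Fin d) (Fin d) ℂ)
    (x : UGroup d × Fin d) : ℝ :=
  (O * reconstructionMap 𝒰 (snapshot x.1 x.2)).trace.re

/-- The variance `𝕍(O, ρ)` of the estimator in standard shadow estimation, where every
sampled unitary is used for a single measurement. -/
def shadowVariance {d : ℕ} (𝒰 : Measure (UGroup d)) (O ρ : Matrix (Fin d) (Fin d) ℂ) : ℝ :=
  ProbabilityTheory.variance (shadowEstimator 𝒰 O) (roundLaw 𝒰 ρ)

/-- The Schatten 2-norm `‖A‖₂ = √Tr(A† A)`. -/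
def schattenTwoNorm {d : ℕ} (A : Matrix (Fin d) (Fin d) ℂ) : ℝ :=
  √((Aᴴ * A).trace.re)

end ShadowEstimation

end

noncomputable section

namespace ShadowEstimation

variable {d : ℕ}

/-! ### Invariance of the Haar measure and integrability -/

/-! The design hypothesis replaces every cubic average of diagonal elements `⟨s|U A U†|s⟩` by its
Haar value, so everything rests on `∫ ⟨A⟩⟨B⟩⟨C⟩` for a single Haar random row. For diagonal
operators this reduces to the third moments of the weights `|U s i|²`. Right invariance under three
kinds of explicit unitaries (phases, swaps, and a quarter turn in a coordinate plane) fixes the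
ratios of these moments, and `∑ weights = 1` fixes the scale. Conjugation by a unitary then extends
the formula from diagonal to Hermitian operators.

Taking `B = 1` gives the second moments, hence `𝓜(A) = (A + tr A) / (d + 1)`, with inverse `B ↦ (d +
1) B - tr B`. For traceless `O` the estimator is therefore `(d + 1)⟨s|U O U†|s⟩`; weighting its
square by the Born probability gives the moment of `O, O, ρ`, and the variance follows.

The trace inequality becomes, in an eigenbasis of `Q`, a statement about a probability vector and
real numbers. Together with `(d + 1) / (d + 2) ≤ 1` it yields the bound on the variance. -/

instance instIsProbabilityMeasureHaarUnitary (d : ℕ) : IsProbabilityMeasure (haarUnitary d) :=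
  ⟨by simpa [haarUnitary] using
    Measure.haarMeasure_self (K₀ := (⊤ : TopologicalSpace.PositiveCompacts (UGroup d)))⟩

instance instIsHaarMeasureHaarUnitary (d : ℕ) : (haarUnitary d).IsHaarMeasure :=
  inferInstanceAs (Measure.haarMeasure _).IsHaarMeasure

/-- A right translate of Haar measure is again a left-invariant probability measure, so uniqueness
identifies the two. -/
instance instIsMulRightInvariantHaarUnitary (d : ℕ) : (haarUnitary d).IsMulRightInvariant := by
  refine ⟨fun g => ?_⟩
  have : IsProbabilityMeasure ((haarUnitary d).map (· * g)) :=
    Measure.isProbabilityMeasure_map (by fun_prop)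
  exact Measure.isHaarMeasure_eq_of_isProbabilityMeasure _ _

lemma integrable_of_continuous {E : Type*} [NormedAddCommGroup E] [SecondCountableTopology E]
    (μ : Measure (UGroup d)) [IsFiniteMeasure μ] {f : UGroup d → E} (hf : Continuous f) :
    Integrable f μ := by
  refine (integrableOn_univ).mp ?_
  obtain ⟨C, hC⟩ := isCompact_univ.exists_bound_of_continuousOn hf.continuousOn
  rw [integrableOn_univ]
  exact Integrable.of_bound hf.aestronglyMeasurable C (.of_forall fun x => hC x trivial)

@[fun_prop]
lemma continuous_entry (i j : Fin d) : Continuous fun U : UGroup d => U.1 i j :=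
  continuous_subtype_val.matrix_elem i j

/-! ### Complex reflections -/

/-- The unitary acting as `ω` on the range of the orthogonal projection `P` and trivially on its
kernel. -/
def reflection (P : Matrix (Fin d) (Fin d) ℂ) (hP : P.IsHermitian) (hPP : P * P = P) (ω : ℂ)
    (hω : ω * star ω = 1) : UGroup d :=
  ⟨1 + (ω - 1) • P, by
    rw [Matrix.mem_unitaryGroup_iff, Matrix.star_eq_conjTranspose, Matrix.conjTranspose_add,
      Matrix.conjTranspose_smul, hP.eq, Matrix.conjTranspose_one]
    have : (1 + (ω - 1) • P) * (1 + star (ω - 1) • P) =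
        1 + (ω * star ω - 1) • P := by
      simp only [add_mul, mul_add, one_mul, mul_one, smul_mul_assoc, mul_smul_comm, hPP, star_sub,
        star_one]
      module
    rw [this, hω]
    simp⟩

/-- The projection onto the line spanned by `|i⟩ + |j⟩`. -/
def pairProj (i j : Fin d) : Matrix (Fin d) (Fin d) ℂ :=
  (1 / 2 : ℂ) • (Matrix.single i i 1 + Matrix.single i j 1 + Matrix.single j i 1 +
    Matrix.single j j 1)

lemma isHermitian_pairProj (i j : Fin d) : (pairProj i j).IsHermitian := by
  simp only [Matrix.IsHermitian, pairProj, Matrix.conjTranspose_smul, Matrix.conjTranspose_add,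
    Matrix.conjTranspose_single]
  simp only [star_one, one_div, star_inv₀, star_ofNat]
  module

lemma pairProj_mul_self {i j : Fin d} (hij : i ≠ j) : pairProj i j * pairProj i j = pairProj i j := by
  simp only [pairProj, smul_mul_assoc, mul_smul_comm, mul_add, add_mul,
    Matrix.single_mul_single_same, Matrix.single_mul_single_of_ne _ _ _ _ hij,
    Matrix.single_mul_single_of_ne _ _ _ _ hij.symm, mul_one]
  module

/-- The unitary multiplying `|i⟩ + |j⟩` by `ω`. -/
def pairReflection {i j : Fin d} (hij : i ≠ j) (ω : ℂ) (hω : ω * star ω = 1) : UGroup d :=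
  reflection (pairProj i j) (isHermitian_pairProj i j) (pairProj_mul_self hij) ω hω

/-- The unitary multiplying `|i⟩` by `ω`. -/
def phase (i : Fin d) (ω : ℂ) (hω : ω * star ω = 1) : UGroup d :=
  reflection (Matrix.single i i 1) (by simp [Matrix.IsHermitian]) (by simp) ω hω

lemma mul_phase_apply (U : UGroup d) (i : Fin d) (ω : ℂ) (hω : ω * star ω = 1) (s k : Fin d) :
    (U * phase i ω hω).1 s k = if k = i then ω * U.1 s k else U.1 s k := by
  simp only [phase, reflection, Submonoid.coe_mul, mul_add, mul_one, mul_smul_comm,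
    Matrix.add_apply, Matrix.smul_apply, smul_eq_mul]
  split_ifs with h
  · subst h
    simp
    ring
  · simp [Matrix.mul_single_apply_of_ne _ _ _ _ _ h]

lemma mul_pairReflection_apply (U : UGroup d) {i j : Fin d} (hij : i ≠ j) (ω : ℂ)
    (hω : ω * star ω = 1) (s k : Fin d) :
    (U * pairReflection hij ω hω).1 s k =
      if k = i ∨ k = j then U.1 s k + (ω - 1) / 2 * (U.1 s i + U.1 s j) else U.1 s k := by
  simp only [pairReflection, reflection, pairProj, Submonoid.coe_mul, mul_add, mul_one,
    mul_smul_comm, Matrix.add_apply, Matrix.smul_apply, smul_eq_mul]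
  split_ifs with h
  · rcases h with rfl | rfl
    · simp [Matrix.mul_single_apply_of_ne _ _ _ _ _ hij]
      ring
    · simp [Matrix.mul_single_apply_of_ne _ _ _ _ _ hij.symm]
      ring
  · push Not at h
    simp [Matrix.mul_single_apply_of_ne _ _ _ _ _ h.1, Matrix.mul_single_apply_of_ne _ _ _ _ _ h.2]

/-! ### Third moments of a row of a Haar random unitary -/

/-- The squared modulus of a matrix entry, as a complex number. -/
def weight (s i : Fin d) (U : UGroup d) : ℂ := U.1 s i * star (U.1 s i)

@[fun_prop]
lemma continuous_weight (s i : Fin d) : Continuous (weight s i) := by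
  unfold weight
  fun_prop

lemma sum_weight (s : Fin d) (U : UGroup d) : ∑ i, weight s i U = 1 := by
  have := congrFun₂ (Matrix.mem_unitaryGroup_iff.mp U.2) s s
  simpa [Matrix.mul_apply, weight] using this

lemma weight_mul_phase (s k i : Fin d) (ω : ℂ) (hω : ω * star ω = 1) (U : UGroup d) :
    weight s k (U * phase i ω hω) = weight s k U := by
  simp only [weight, mul_phase_apply]
  split_ifs
  · rw [star_mul']
    linear_combination U.1 s k * star (U.1 s k) * hω
  · rfl

lemma weight_mul_pairReflection_of_ne (s : Fin d) {i j k : Fin d} (hij : i ≠ j) (hki : k ≠ i)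
    (hkj : k ≠ j) (ω : ℂ) (hω : ω * star ω = 1) (U : UGroup d) :
    weight s k (U * pairReflection hij ω hω) = weight s k U := by
  simp [weight, mul_pairReflection_apply, hki, hkj]

lemma weight_add_mul_pairReflection (s : Fin d) {i j : Fin d} (hij : i ≠ j) (ω : ℂ)
    (hω : ω * star ω = 1) (U : UGroup d) :
    weight s i (U * pairReflection hij ω hω) + weight s j (U * pairReflection hij ω hω) =
      weight s i U + weight s j U := by
  simp only [weight, mul_pairReflection_apply, true_or, or_true, if_true, star_add, star_mul',
    star_div₀, star_sub, star_one, star_ofNat]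
  linear_combination (U.1 s i + U.1 s j) * (star (U.1 s i) + star (U.1 s j)) / 2 * hω

/-- With `ω = -1` the reflection sends `|i⟩` to `-|j⟩` and `|j⟩` to `-|i⟩`; the signs disappear in
the moduli. -/
lemma weight_mul_swap (s : Fin d) {i j : Fin d} (hij : i ≠ j) (U : UGroup d) :
    weight s i (U * pairReflection hij (-1) (by simp)) = weight s j U ∧
    weight s j (U * pairReflection hij (-1) (by simp)) = weight s i U := by
  simp only [weight, mul_pairReflection_apply, true_or, or_true, if_true, star_add, star_mul',
    star_div₀, star_sub, star_one, star_ofNat, star_neg]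
  constructor <;> ring

/-- For a random unit vector and a function `f` invariant under the rotations of the plane of `i`
and `j`, one has `E[f (pᵢ² + pⱼ²)] = 4 E[f pᵢ pⱼ]`. -/
lemma integral_sq_weight_add (s : Fin d) {i j : Fin d} (hij : i ≠ j) {f : UGroup d → ℂ}
    (hf : Continuous f)
    (hpair : ∀ U, f (U * pairReflection hij Complex.I (by simp)) = f U)
    (hphase : ∀ U, f (U * phase j Complex.I (by simp)) = f U) :
    ∫ U, f U * (weight s i U ^ 2 + weight s j U ^ 2) ∂(haarUnitary d) =
      4 * ∫ U, f U * (weight s i U * weight s j U) ∂(haarUnitary d) := by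
  -- With `a = U s i`, `b = U s j`, use Bloch coordinates `x = 2 Re(a b̄)`, `y = 2 Im(a b̄)`, `z =
  -- |a|² - |b|²`, `n = |a|² + |b|²`, so that `x² + y² + z² = n²`. The product of weights is `(n² -
  -- z²) / 4`; the quarter turn replaces `z²` by `y²`, and the phase in `h2` then replaces `y²` by
  -- `x²`.
  have h1 : ∫ U, f U * (weight s i U * weight s j U) ∂(haarUnitary d) =
      ∫ U, f U * ((weight s i U + weight s j U) ^ 2 / 4 +
        (U.1 s i * star (U.1 s j) - star (U.1 s i) * U.1 s j) ^ 2 / 4) ∂(haarUnitary d) := by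
    rw [← integral_mul_right_eq_self _ (pairReflection hij Complex.I (by simp))]
    refine integral_congr_ae (.of_forall fun U => ?_)
    simp only [hpair, weight, mul_pairReflection_apply, true_or, or_true, if_true, star_add,
      star_mul', star_div₀, star_sub, star_one, star_ofNat]
    rw [show star Complex.I = -Complex.I from Complex.conj_I]
    clear hpair hphase
    have hI := Complex.I_sq
    generalize star (U.1 s i) = a'
    generalize star (U.1 s j) = b'
    generalize U.1 s i = a
    generalize U.1 s j = b
    generalize Complex.I = t at *
    have h4 : t ^ 4 = 1 := by linear_combination (t ^ 2 - 1) * hI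
    ring_nf
    simp only [h4, hI]
    ring
  have h2 : ∫ U, f U * (weight s i U * weight s j U) ∂(haarUnitary d) =
      ∫ U, f U * ((weight s i U + weight s j U) ^ 2 / 4 -
        (U.1 s i * star (U.1 s j) + star (U.1 s i) * U.1 s j) ^ 2 / 4) ∂(haarUnitary d) := by
    rw [h1, ← integral_mul_right_eq_self _ (phase j Complex.I (by simp))]
    refine integral_congr_ae (.of_forall fun U => ?_)
    simp only [hphase, weight_mul_phase, mul_phase_apply, hij, if_true, if_false, star_mul']
    rw [show star Complex.I = -Complex.I from Complex.conj_I]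
    linear_combination f U * (U.1 s i * star (U.1 s j) + star (U.1 s i) * U.1 s j) ^ 2 / 4 *
      Complex.I_sq
  -- Pointwise, the sum of squares is `(n² + z²) / 2 = 2 ((n² - y²) / 4 + (n² - x²) / 4)`.
  have h4 : ∫ U, f U * (weight s i U ^ 2 + weight s j U ^ 2) ∂(haarUnitary d) =
      ∫ U, 2 * (f U * ((weight s i U + weight s j U) ^ 2 / 4 +
        (U.1 s i * star (U.1 s j) - star (U.1 s i) * U.1 s j) ^ 2 / 4) +
        f U * ((weight s i U + weight s j U) ^ 2 / 4 -
        (U.1 s i * star (U.1 s j) + star (U.1 s i) * U.1 s j) ^ 2 / 4)) ∂(haarUnitary d) := by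
    refine integral_congr_ae (.of_forall fun U => ?_)
    simp only [weight]
    ring
  rw [h4, integral_const_mul, integral_add (integrable_of_continuous _ (by fun_prop))
    (integrable_of_continuous _ (by fun_prop)), ← h1, ← h2]
  ring

/-- The third moments of the outcome weights of a Haar random unitary. -/
def moment (s i j k : Fin d) : ℂ :=
  ∫ U, weight s i U * weight s j U * weight s k U ∂(haarUnitary d)

lemma moment_comm₁₂ (s i j k : Fin d) : moment s i j k = moment s j i k := by
  simp only [moment, mul_comm (weight s i _)]

lemma moment_comm₂₃ (s i j k : Fin d) : moment s i j k = moment s i k j := by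
  simp only [moment, mul_right_comm]

lemma moment_swap (s : Fin d) {i j : Fin d} (hij : i ≠ j) :
    moment s i i i = moment s j j j ∧ moment s i i j = moment s j j i ∧
    ∀ k, k ≠ i → k ≠ j → moment s i i k = moment s j j k := by
  refine ⟨?_, ?_, fun k hki hkj => ?_⟩ <;>
  · conv_rhs => rw [moment, ← integral_mul_right_eq_self _ (pairReflection hij (-1) (by simp))]
    first
    | simp only [moment, (weight_mul_swap s hij _).2,
        weight_mul_pairReflection_of_ne s hij hki hkj]
    | simp only [moment, (weight_mul_swap s hij _).1, (weight_mul_swap s hij _).2]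

lemma moment_of_distinct (s : Fin d) {i j k : Fin d} (hij : i ≠ j) (hki : k ≠ i) (hkj : k ≠ j) :
    moment s i i k = 2 * moment s i j k := by
  have h := integral_sq_weight_add s hij (continuous_weight s k)
    (fun U => weight_mul_pairReflection_of_ne s hij hki hkj _ _ U)
    (fun U => weight_mul_phase s k j _ _ U)
  have h' : ∫ U, weight s k U * (weight s i U ^ 2 + weight s j U ^ 2) ∂(haarUnitary d) =
      moment s i i k + moment s j j k := by
    rw [moment, moment, ← integral_add (integrable_of_continuous _ (by fun_prop))
      (integrable_of_continuous _ (by fun_prop))]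
    congr! 2 with U
    ring
  have h'' : ∫ U, weight s k U * (weight s i U * weight s j U) ∂(haarUnitary d) =
      moment s i j k := by
    simp only [moment, mul_comm (weight s k _)]
  rw [h', h'', ← (moment_swap s hij).2.2 k hki hkj] at h
  linear_combination h / 2

/-- Apply the plane identity with `f = pᵢ + pⱼ`, which is invariant although neither summand is. -/
lemma moment_cube (s : Fin d) {i j : Fin d} (hij : i ≠ j) :
    moment s i i i = 3 * moment s i i j := by
  have h := integral_sq_weight_add s hij (f := fun U => weight s i U + weight s j U)
    (by fun_prop) (fun U => weight_add_mul_pairReflection s hij _ _ U)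
    (fun U => by simp only [weight_mul_phase])
  have h' : ∫ U, (weight s i U + weight s j U) * (weight s i U ^ 2 + weight s j U ^ 2)
      ∂(haarUnitary d) = moment s i i i + moment s j j j + (moment s i i j + moment s j j i) := by
    simp only [moment]
    rw [← integral_add, ← integral_add, ← integral_add]
    · congr! 2 with U
      ring
    all_goals exact integrable_of_continuous _ (by fun_prop)
  have h'' : ∫ U, (weight s i U + weight s j U) * (weight s i U * weight s j U)
      ∂(haarUnitary d) = moment s i i j + moment s j j i := by
    simp only [moment]
    rw [← integral_add]
    · congr! 2 with U
      ring
    all_goals exact integrable_of_continuous _ (by fun_prop)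
  rw [h', h'', ← (moment_swap s hij).1, ← (moment_swap s hij).2.1] at h
  linear_combination h / 2

/-- The last factor counts the permutations in `S₃` fixing the word `(i, j, k)`: 6, 2 or 1. The row
index `s` also serves as a reference column, since all columns are equivalent. -/
lemma moment_eq_mul (s i j k : Fin d) :
    moment s i j k = moment s s s s / 6 *
      ((1 + if j = k then 1 else 0) * (1 + (if j = i then 1 else 0) + if k = i then 1 else 0)) := by
  have hdiag : ∀ i, moment s s s s = moment s i i i := fun i => by
    rcases eq_or_ne s i with rfl | h
    · rfl
    · exact (moment_swap s h).1
  have hpair : ∀ {i j}, i ≠ j → moment s i i j = moment s s s s / 3 := fun {i j} h => by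
    rw [hdiag i, moment_cube s h]
    ring
  by_cases hjk : j = k
  · subst hjk
    by_cases hji : j = i
    · subst hji
      simp [← hdiag]
      ring
    · rw [moment_comm₁₂, moment_comm₂₃, hpair hji]
      simp [hji]
      ring
  · by_cases hji : j = i
    · subst hji
      rw [hpair hjk]
      simp [hjk, Ne.symm hjk]
      ring
    · by_cases hki : k = i
      · subst hki
        rw [moment_comm₂₃, hpair (Ne.symm hjk)]
        simp [hjk]
        ring
      · have := moment_of_distinct s (Ne.symm hji) hki (Ne.symm hjk)
        rw [hpair (Ne.symm hki)] at this
        simp [hji, hjk, hki]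
        linear_combination -this / 2

/-- Expanding the stabilizer count gives one term per element of `S₃`: the identity, three
transpositions, and two 3-cycles that contribute equally. -/
lemma sum_moment_pattern (x y z : Fin d → ℂ) :
    ∑ i, ∑ j, ∑ k, z i * x j * y k * ((1 + if j = k then 1 else 0) *
      (1 + (if j = i then 1 else 0) + if k = i then 1 else 0)) =
    (∑ i, x i) * (∑ i, y i) * (∑ i, z i) + (∑ i, x i * y i) * (∑ i, z i) +
      (∑ i, x i * z i) * (∑ i, y i) + (∑ i, y i * z i) * (∑ i, x i) +
      2 * ∑ i, x i * y i * z i := by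
  have key (i j k : Fin d) : z i * x j * y k * ((1 + if j = k then 1 else 0) *
      (1 + (if j = i then 1 else 0) + if k = i then 1 else 0)) =
      z i * x j * y k + (if j = k then z i * x j * y k else 0) +
      (if j = i then z i * x j else 0) * y k + (if k = i then z i * x j * y k else 0) +
      2 * (if j = k then if j = i then z i * x j * y k else 0 else 0) := by
    split_ifs <;> first | ring1 | (exfalso; simp_all)
  simp only [key, Finset.sum_add_distrib, ← Finset.mul_sum, Finset.sum_ite_eq, Finset.sum_ite_eq',
    Finset.mem_univ, if_true]
  have h1 : ∑ i, ∑ j, z i * x j = (∑ i, z i) * ∑ i, x i := by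
    rw [Finset.sum_mul_sum]
  have h2 : ∑ i, ∑ j, z i * x j * y j = (∑ i, z i) * ∑ i, x i * y i := by
    simp only [Finset.sum_mul_sum, mul_assoc]
  have h3 : ∑ i, (∑ j, z i * x j) * y i = (∑ i, y i * z i) * ∑ i, x i := by
    simp only [← Finset.mul_sum]
    rw [Finset.sum_mul]
    exact Finset.sum_congr rfl fun i _ => by ring
  simp only [← Finset.sum_mul, Finset.sum_ite_eq', Finset.mem_univ, if_true, h1, h2, h3]
  simp only [← mul_comm (z _), mul_assoc]
  ring

/-- All moments add up to `(∑ weights)³ = 1`, while the stabilizer counts add up to `d³ + 3d² + 2d =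
d(d + 1)(d + 2)`. -/
lemma moment_const (s : Fin d) :
    moment s s s s / 6 = 1 / ((d : ℂ) * ((d : ℂ) + 1) * ((d : ℂ) + 2)) := by
  have h1 : ∑ i, ∑ j, ∑ k, moment s i j k = 1 := by
    have h (U : UGroup d) : ∑ i, ∑ j, ∑ k, weight s i U * weight s j U * weight s k U = 1 := by
      simp only [← Finset.mul_sum, sum_weight, mul_one]
    have hint : ∫ U, ∑ i, ∑ j, ∑ k, weight s i U * weight s j U * weight s k U ∂(haarUnitary d) =
        1 := by simp [h]
    rw [← hint, integral_finsetSum _ fun i _ => integrable_of_continuous _ (by fun_prop)]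
    refine Finset.sum_congr rfl fun i _ => ?_
    rw [integral_finsetSum _ fun i _ => integrable_of_continuous _ (by fun_prop)]
    refine Finset.sum_congr rfl fun j _ => ?_
    rw [integral_finsetSum _ fun i _ => integrable_of_continuous _ (by fun_prop)]
    rfl
  have h2 := sum_moment_pattern (d := d) (fun _ => 1) (fun _ => 1) (fun _ => 1)
  simp only [one_mul] at h2
  rw [Finset.sum_congr rfl fun i _ => Finset.sum_congr rfl fun j _ => Finset.sum_congr rfl
    fun k _ => moment_eq_mul s i j k] at h1
  simp only [← Finset.mul_sum] at h1
  rw [h2] at h1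
  have hd : (d : ℂ) * ((d : ℂ) + 1) * ((d : ℂ) + 2) ≠ 0 := by
    have := s.pos
    norm_cast
    positivity
  rw [eq_div_iff hd]
  simp only [Finset.sum_const, Finset.card_univ, Fintype.card_fin, nsmul_eq_mul, mul_one] at h1
  linear_combination h1

/-- The mixed moments needed for the third-order twirl: an off-diagonal coherence averages to
zero. -/
lemma integral_weight_mul_weight_mul_entry (s j k a b : Fin d) :
    ∫ U, weight s j U * weight s k U * (U.1 s a * star (U.1 s b)) ∂(haarUnitary d) =
      if a = b then moment s a j k else 0 := by
  split_ifs with h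
  · subst h
    simp only [moment, weight]
    congr! 2 with U
    ring
  -- Flipping the sign of column `a` negates the integrand, so the integral equals its own negative.
  · have := integral_mul_right_eq_self (μ := haarUnitary d)
      (fun U : UGroup d => weight s j U * weight s k U * (U.1 s a * star (U.1 s b)))
      (phase a (-1) (by simp))
    simp only [weight_mul_phase, mul_phase_apply, if_true, Ne.symm h, if_false, neg_mul, one_mul,
      mul_neg, integral_neg] at this
    linear_combination -this / 2

/-! ### Third-order twirls of diagonal matrix elements -/

/-- The diagonal matrix element `⟨s|U A U†|s⟩`. -/
def outcomeElem (s : Fin d) (A : Matrix (Fin d) (Fin d) ℂ) (U : UGroup d) : ℂ :=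
  (U.1 * A * U.1ᴴ) s s

lemma outcomeElem_eq_sum (s : Fin d) (A : Matrix (Fin d) (Fin d) ℂ) (U : UGroup d) :
    outcomeElem s A U = ∑ a, ∑ b, A a b * (U.1 s a * star (U.1 s b)) := by
  simp only [outcomeElem, Matrix.mul_apply, Finset.sum_mul, Matrix.conjTranspose_apply]
  rw [Finset.sum_comm]
  exact Finset.sum_congr rfl fun a _ => Finset.sum_congr rfl fun b _ => by ring

@[fun_prop]
lemma continuous_outcomeElem (s : Fin d) (A : Matrix (Fin d) (Fin d) ℂ) :
    Continuous (outcomeElem s A) := by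
  simp_rw [funext (outcomeElem_eq_sum s A)]
  fun_prop

lemma outcomeElem_one (s : Fin d) (U : UGroup d) : outcomeElem s 1 U = 1 := by
  have hU : U.1 * U.1ᴴ = 1 := Matrix.mem_unitaryGroup_iff.mp U.2
  rw [outcomeElem, mul_one, hU, Matrix.one_apply_eq]

lemma outcomeElem_add (s : Fin d) (A B : Matrix (Fin d) (Fin d) ℂ) (U : UGroup d) :
    outcomeElem s (A + B) U = outcomeElem s A U + outcomeElem s B U := by
  simp [outcomeElem, mul_add, add_mul]

lemma outcomeElem_smul (s : Fin d) (c : ℂ) (A : Matrix (Fin d) (Fin d) ℂ) (U : UGroup d) :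
    outcomeElem s (c • A) U = c * outcomeElem s A U := by
  simp [outcomeElem]

lemma outcomeElem_diagonal (s : Fin d) (x : Fin d → ℂ) (U : UGroup d) :
    outcomeElem s (Matrix.diagonal x) U = ∑ i, x i * weight s i U := by
  simp [outcomeElem_eq_sum, Matrix.diagonal_apply, weight]

lemma outcomeElem_mul_right (s : Fin d) (A : Matrix (Fin d) (Fin d) ℂ) (U V : UGroup d) :
    outcomeElem s A (U * V) = outcomeElem s (V.1 * A * V.1ᴴ) U := by
  simp [outcomeElem, Matrix.conjTranspose_mul, mul_assoc]

lemma sum_outcomeElem (A : Matrix (Fin d) (Fin d) ℂ) (U : UGroup d) :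
    ∑ s, outcomeElem s A U = A.trace := by
  have hU : U.1ᴴ * U.1 = 1 := Matrix.mem_unitaryGroup_iff'.mp U.2
  change (U.1 * A * U.1ᴴ).trace = _
  rw [Matrix.trace_mul_comm, ← mul_assoc, hU, one_mul]

lemma ofReal_re_outcomeElem (s : Fin d) {A : Matrix (Fin d) (Fin d) ℂ} (hA : A.IsHermitian)
    (U : UGroup d) : ((outcomeElem s A U).re : ℂ) = outcomeElem s A U := by
  have : (U.1 * A * U.1ᴴ).IsHermitian := Matrix.isHermitian_mul_mul_conjTranspose _ hA
  exact this.coe_re_apply_self s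

/-- The symmetric third-order twirl form. -/
def twirlForm (A B C : Matrix (Fin d) (Fin d) ℂ) : ℂ :=
  (A.trace * B.trace * C.trace + (A * B).trace * C.trace + (A * C).trace * B.trace +
    (B * C).trace * A.trace + 2 * (A * B * C).trace) /
    ((d : ℂ) * ((d : ℂ) + 1) * ((d : ℂ) + 2))

/-- `C` may be arbitrary because its off-diagonal entries average to zero. The two diagonal matrices
commute, which is why `2 tr(ABC)` can stand for `tr(ABC) + tr(ACB)`. -/
lemma integral_outcomeElem_diagonal (s : Fin d) (x y : Fin d → ℂ)
    (C : Matrix (Fin d) (Fin d) ℂ) :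
    ∫ U, outcomeElem s (Matrix.diagonal x) U * outcomeElem s (Matrix.diagonal y) U *
      outcomeElem s C U ∂(haarUnitary d) =
      twirlForm (Matrix.diagonal x) (Matrix.diagonal y) C := by
  have h (U : UGroup d) : outcomeElem s (Matrix.diagonal x) U *
      outcomeElem s (Matrix.diagonal y) U * outcomeElem s C U =
      ∑ a, ∑ b, ∑ j, ∑ k, C a b * x j * y k *
        (weight s j U * weight s k U * (U.1 s a * star (U.1 s b))) := by
    rw [outcomeElem_diagonal, outcomeElem_diagonal, outcomeElem_eq_sum, Finset.mul_sum]
    refine Finset.sum_congr rfl fun a _ => ?_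
    rw [Finset.mul_sum]
    refine Finset.sum_congr rfl fun b _ => ?_
    rw [Finset.sum_mul_sum, Finset.sum_mul]
    refine Finset.sum_congr rfl fun j _ => ?_
    rw [Finset.sum_mul]
    exact Finset.sum_congr rfl fun k _ => by ring
  have h' : ∫ U, outcomeElem s (Matrix.diagonal x) U * outcomeElem s (Matrix.diagonal y) U *
      outcomeElem s C U ∂(haarUnitary d) =
      ∑ a, ∑ b, ∑ j, ∑ k, C a b * x j * y k * if a = b then moment s a j k else 0 := by
    simp_rw [h]
    rw [integral_finsetSum _ fun a _ => integrable_of_continuous _ (by fun_prop)]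
    refine Finset.sum_congr rfl fun a _ => ?_
    rw [integral_finsetSum _ fun b _ => integrable_of_continuous _ (by fun_prop)]
    refine Finset.sum_congr rfl fun b _ => ?_
    rw [integral_finsetSum _ fun j _ => integrable_of_continuous _ (by fun_prop)]
    refine Finset.sum_congr rfl fun j _ => ?_
    rw [integral_finsetSum _ fun k _ => integrable_of_continuous _ (by fun_prop)]
    refine Finset.sum_congr rfl fun k _ => ?_
    rw [integral_const_mul, integral_weight_mul_weight_mul_entry]
  rw [h']
  have h'' (a b : Fin d) : ∑ j, ∑ k, C a b * x j * y k * (if a = b then moment s a j k else 0) =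
      if a = b then ∑ j, ∑ k, C a b * x j * y k * moment s a j k else 0 := by
    split_ifs <;> simp
  simp only [h'', Finset.sum_ite_eq, Finset.mem_univ, if_true]
  have h3 := sum_moment_pattern x y (fun a => C a a)
  have h4 (a j k : Fin d) : C a a * x j * y k * moment s a j k = moment s s s s / 6 *
      (C a a * x j * y k * ((1 + if j = k then 1 else 0) *
        (1 + (if j = a then 1 else 0) + if k = a then 1 else 0))) := by
    rw [moment_eq_mul]
    ring
  simp only [h4, ← Finset.mul_sum]
  rw [h3, moment_const, twirlForm]
  simp only [Matrix.trace, Matrix.diag, Matrix.diagonal_mul_diagonal, Matrix.diagonal_mul,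
    Matrix.diagonal_apply_eq]
  ring

lemma twirlForm_conj (A B C V : Matrix (Fin d) (Fin d) ℂ) (hV : Vᴴ * V = 1) :
    twirlForm (V * A * Vᴴ) (V * B * Vᴴ) (V * C * Vᴴ) = twirlForm A B C := by
  have hmul (X Y : Matrix (Fin d) (Fin d) ℂ) : V * X * Vᴴ * (V * Y * Vᴴ) = V * (X * Y) * Vᴴ := by
    calc V * X * Vᴴ * (V * Y * Vᴴ) = V * X * (Vᴴ * V) * Y * Vᴴ := by simp only [mul_assoc]
      _ = _ := by rw [hV, mul_one, mul_assoc V X Y]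
  have htr (X : Matrix (Fin d) (Fin d) ℂ) : (V * X * Vᴴ).trace = X.trace := by
    rw [Matrix.trace_mul_comm, ← mul_assoc, hV, one_mul]
  simp only [twirlForm, hmul, htr]

lemma exists_unitary_diagonal {A : Matrix (Fin d) (Fin d) ℂ} (hA : A.IsHermitian) :
    ∃ (V : UGroup d) (x : Fin d → ℝ), A = V.1 * Matrix.diagonal (fun i => (x i : ℂ)) * V.1ᴴ :=
  ⟨hA.eigenvectorUnitary, hA.eigenvalues, hA.spectral_theorem⟩

lemma integral_outcomeElem_conj (s : Fin d) (V : UGroup d) (x y : Fin d → ℂ)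
    (C : Matrix (Fin d) (Fin d) ℂ) :
    ∫ U, outcomeElem s (V.1 * Matrix.diagonal x * V.1ᴴ) U *
      outcomeElem s (V.1 * Matrix.diagonal y * V.1ᴴ) U * outcomeElem s C U ∂(haarUnitary d) =
      twirlForm (V.1 * Matrix.diagonal x * V.1ᴴ) (V.1 * Matrix.diagonal y * V.1ᴴ) C := by
  have hV : V.1ᴴ * V.1 = 1 := Matrix.mem_unitaryGroup_iff'.mp V.2
  have hV' : V.1 * V.1ᴴ = 1 := Matrix.mem_unitaryGroup_iff.mp V.2
  obtain ⟨C, rfl⟩ : ∃ C', C = V.1 * C' * V.1ᴴ := by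
    refine ⟨V.1ᴴ * C * V.1, ?_⟩
    calc C = (V.1 * V.1ᴴ) * C * (V.1 * V.1ᴴ) := by rw [hV', one_mul, mul_one]
      _ = _ := by simp only [mul_assoc]
  rw [twirlForm_conj _ _ _ _ hV, ← integral_outcomeElem_diagonal s]
  simp_rw [← outcomeElem_mul_right]
  exact integral_mul_right_eq_self
    (fun U => outcomeElem s (Matrix.diagonal x) U * outcomeElem s (Matrix.diagonal y) U *
      outcomeElem s C U) V

lemma integral_outcomeElem_sq (s : Fin d) {A : Matrix (Fin d) (Fin d) ℂ} (hA : A.IsHermitian)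
    (C : Matrix (Fin d) (Fin d) ℂ) :
    ∫ U, outcomeElem s A U * outcomeElem s A U * outcomeElem s C U ∂(haarUnitary d) =
      twirlForm A A C := by
  obtain ⟨V, x, rfl⟩ := exists_unitary_diagonal hA
  exact integral_outcomeElem_conj s V _ _ C

/-- Both sides are linear in `A`, so the Hermitian case suffices. The general case is needed because
the channel acts on all matrices. -/
lemma integral_outcomeElem_mul_one (s : Fin d) (A C : Matrix (Fin d) (Fin d) ℂ) :
    ∫ U, outcomeElem s A U * outcomeElem s 1 U * outcomeElem s C U ∂(haarUnitary d) =
      twirlForm A 1 C := by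
  have herm {A : Matrix (Fin d) (Fin d) ℂ} (hA : A.IsHermitian) :
      ∫ U, outcomeElem s A U * outcomeElem s 1 U * outcomeElem s C U ∂(haarUnitary d) =
        twirlForm A 1 C := by
    obtain ⟨V, x, rfl⟩ := exists_unitary_diagonal hA
    have hV : V.1 * V.1ᴴ = 1 := Matrix.mem_unitaryGroup_iff.mp V.2
    have := integral_outcomeElem_conj s V (fun i => (x i : ℂ)) 1 C
    rwa [show Matrix.diagonal (1 : Fin d → ℂ) = 1 from Matrix.diagonal_one, mul_one, hV] at this
  have hA : A = (realPart A : Matrix (Fin d) (Fin d) ℂ) +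
    Complex.I • (imaginaryPart A : Matrix (Fin d) (Fin d) ℂ) :=
    (realPart_add_I_smul_imaginaryPart A).symm
  have h1 := herm (A := (realPart A : Matrix (Fin d) (Fin d) ℂ)) (realPart A).2
  have h2 := herm (A := (imaginaryPart A : Matrix (Fin d) (Fin d) ℂ)) (imaginaryPart A).2
  generalize (realPart A : Matrix (Fin d) (Fin d) ℂ) = H at *
  generalize (imaginaryPart A : Matrix (Fin d) (Fin d) ℂ) = K at *
  subst hA
  have : twirlForm (H + Complex.I • K) 1 C = twirlForm H 1 C + Complex.I * twirlForm K 1 C := by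
    simp only [twirlForm, add_mul, mul_one, one_mul, smul_mul_assoc, Matrix.trace_add,
      Matrix.trace_smul, smul_eq_mul]
    ring
  rw [this, ← h1, ← h2, ← integral_const_mul, ← integral_add
    (integrable_of_continuous _ (by fun_prop)) (integrable_of_continuous _ (by fun_prop))]
  congr! 2 with U
  rw [outcomeElem_add, outcomeElem_smul]
  ring

/-! ### Unitary 3-designs -/

lemma tensorPow_mul_mul_apply (U A B C : Matrix (Fin d) (Fin d) ℂ) (s : Fin d) :
    (tensorPow 3 U * (Matrix.of fun i j : Fin 3 → Fin d => A (i 0) (j 0) * B (i 1) (j 1) * C (i 2) (j 2)) *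
      (tensorPow 3 U)ᴴ) (fun _ => s) (fun _ => s) =
      (U * A * Uᴴ) s s * (U * B * Uᴴ) s s * (U * C * Uᴴ) s s := by
  have hX : (Matrix.of fun i j : Fin 3 → Fin d => A (i 0) (j 0) * B (i 1) (j 1) * C (i 2) (j 2)) =
      Matrix.of fun i j => ∏ k, ![A, B, C] k (i k) (j k) := by
    ext i j
    exact (Fin.prod_univ_three fun k => ![A, B, C] k (i k) (j k)).symm
  have hmul (F G : Fin 3 → Matrix (Fin d) (Fin d) ℂ) :
      (Matrix.of fun i j : Fin 3 → Fin d => ∏ k, F k (i k) (j k)) *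
        (Matrix.of fun i j : Fin 3 → Fin d => ∏ k, G k (i k) (j k)) =
      Matrix.of fun i j : Fin 3 → Fin d => ∏ k, (F k * G k) (i k) (j k) := by
    ext i j
    simp only [Matrix.mul_apply, Matrix.of_apply, Fintype.prod_sum, ← Finset.prod_mul_distrib]
  have hstar : (tensorPow 3 U)ᴴ = Matrix.of fun i j : Fin 3 → Fin d => ∏ k, Uᴴ (i k) (j k) := by
    ext i j
    simp [tensorPow]
  rw [hX, hstar, tensorPow, hmul (fun _ => U) ![A, B, C], hmul _ fun _ => Uᴴ,
    Matrix.of_apply, Fin.prod_univ_three]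
  rfl

lemma IsUnitaryDesign.integral_outcomeElem {𝒰 : Measure (UGroup d)} (h𝒰 : IsUnitaryDesign 3 𝒰)
    (s : Fin d) (A B C : Matrix (Fin d) (Fin d) ℂ) :
    ∫ U, outcomeElem s A U * outcomeElem s B U * outcomeElem s C U ∂𝒰 =
      ∫ U, outcomeElem s A U * outcomeElem s B U * outcomeElem s C U ∂(haarUnitary d) := by
  set X := Matrix.of fun i j : Fin 3 → Fin d => A (i 0) (j 0) * B (i 1) (j 1) * C (i 2) (j 2)
    with hX
  have h (U : UGroup d) : outcomeElem s A U * outcomeElem s B U * outcomeElem s C U =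
      (tensorPow 3 U.1 * X * (tensorPow 3 U.1)ᴴ) (fun _ => s) (fun _ => s) := by
    rw [hX, tensorPow_mul_mul_apply]
    simp only [outcomeElem]
  simp_rw [h]
  exact h𝒰 X _ _

/-- A 3-design is a 2-design: put the identity in the third slot, and the factor `d + 2` cancels. -/
lemma IsUnitaryDesign.integral_outcomeElem_mul {𝒰 : Measure (UGroup d)}
    (h𝒰 : IsUnitaryDesign 3 𝒰) (s : Fin d) (A C : Matrix (Fin d) (Fin d) ℂ) :
    ∫ U, outcomeElem s A U * outcomeElem s C U ∂𝒰 =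
      (A.trace * C.trace + (A * C).trace) / ((d : ℂ) * ((d : ℂ) + 1)) := by
  have h := (h𝒰.integral_outcomeElem s A 1 C).trans (integral_outcomeElem_mul_one s A C)
  simp only [outcomeElem_one, mul_one] at h
  rw [h, twirlForm]
  have hd := s.pos
  have hd1 : (d : ℂ) ≠ 0 := by exact_mod_cast hd.ne'
  have hd2 : (d : ℂ) + 1 ≠ 0 := by exact_mod_cast (Nat.succ_ne_zero d)
  have hd3 : (d : ℂ) + 2 ≠ 0 := by exact_mod_cast (Nat.succ_ne_zero (d + 1))
  simp only [Matrix.trace_one, Fintype.card_fin, mul_one, one_mul]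
  field_simp
  ring

/-! ### The measurement channel -/

/-- This turns each entry of the channel output into a second moment of diagonal elements. -/
lemma snapshot_apply (U : UGroup d) (s i j : Fin d) :
    snapshot U s i j = outcomeElem s (Matrix.single j i 1) U := by
  rw [outcomeElem_eq_sum, Finset.sum_eq_single j, Finset.sum_eq_single i]
  · rw [snapshot, Matrix.mul_assoc, Matrix.mul_apply, Finset.sum_eq_single s]
    · simp [mul_comm]
    · intro b _ hb
      simp [Matrix.single_mul_apply_of_ne _ _ _ _ _ hb]
    · simp
  · intro b _ hb
    simp [hb.symm]
  · simp
  · intro a _ ha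
    simp [ha.symm]
  · simp

lemma IsUnitaryDesign.measurementChannel_eq {𝒰 : Measure (UGroup d)} [IsProbabilityMeasure 𝒰]
    (h𝒰 : IsUnitaryDesign 3 𝒰) (A : Matrix (Fin d) (Fin d) ℂ) :
    measurementChannel 𝒰 A = (1 / ((d : ℂ) + 1)) • (A + A.trace • 1) := by
  ext i j
  have hd : (d : ℂ) ≠ 0 := by exact_mod_cast i.pos.ne'
  have hd2 : (d : ℂ) + 1 ≠ 0 := by exact_mod_cast (Nat.succ_ne_zero d)
  change ∫ U, ∑ s, outcomeElem s A U * snapshot U s i j ∂𝒰 = _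
  simp_rw [snapshot_apply]
  rw [integral_finsetSum _ fun s _ => integrable_of_continuous _ (by fun_prop)]
  simp_rw [h𝒰.integral_outcomeElem_mul]
  simp only [Finset.sum_const, Finset.card_univ, Fintype.card_fin, nsmul_eq_mul, Matrix.smul_apply,
    Matrix.add_apply, smul_eq_mul, Matrix.trace_mul_single, Matrix.one_apply, one_div]
  rcases eq_or_ne i j with rfl | h
  · simp
    field_simp
    ring
  · simp [h, Matrix.trace_single_eq_of_ne _ _ _ h.symm]
    field_simp

lemma IsUnitaryDesign.bijective_measurementChannel {𝒰 : Measure (UGroup d)}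
    [IsProbabilityMeasure 𝒰] (h𝒰 : IsUnitaryDesign 3 𝒰) :
    Function.Bijective (measurementChannel 𝒰) := by
  have hd2 : (d : ℂ) + 1 ≠ 0 := by exact_mod_cast (Nat.succ_ne_zero d)
  refine Function.bijective_iff_has_inverse.mpr
    -- The channel preserves the trace, so solving `(d + 1) B = A + tr A` only requires replacing
    -- `tr A` by `tr B`.
    ⟨fun B => ((d : ℂ) + 1) • B - B.trace • 1, fun A => ?_, fun B => ?_⟩
  · have : (measurementChannel 𝒰 A).trace = A.trace := by
      rw [h𝒰.measurementChannel_eq]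
      simp
      field_simp
      ring
    simp only [this]
    rw [h𝒰.measurementChannel_eq, smul_smul, mul_one_div_cancel hd2, one_smul, add_sub_cancel_right]
  · rw [h𝒰.measurementChannel_eq]
    have : (((d : ℂ) + 1) • B - B.trace • (1 : Matrix (Fin d) (Fin d) ℂ)).trace = B.trace := by
      simp
      ring
    rw [this, sub_add_cancel, smul_smul, one_div_mul_cancel hd2, one_smul]

lemma IsUnitaryDesign.reconstructionMap_eq {𝒰 : Measure (UGroup d)} [IsProbabilityMeasure 𝒰]
    (h𝒰 : IsUnitaryDesign 3 𝒰) (B : Matrix (Fin d) (Fin d) ℂ) :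
    reconstructionMap 𝒰 B = ((d : ℂ) + 1) • B - B.trace • 1 := by
  have hd2 : (d : ℂ) + 1 ≠ 0 := by exact_mod_cast (Nat.succ_ne_zero d)
  rcases Nat.eq_zero_or_pos d with rfl | hd
  · exact Subsingleton.elim _ _
  apply h𝒰.bijective_measurementChannel.1
  rw [reconstructionMap, Function.rightInverse_invFun h𝒰.bijective_measurementChannel.2,
    h𝒰.measurementChannel_eq]
  have : (((d : ℂ) + 1) • B - B.trace • (1 : Matrix (Fin d) (Fin d) ℂ)).trace = B.trace := by
    simp
    ring
  rw [this, sub_add_cancel, smul_smul, one_div_mul_cancel hd2, one_smul]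

lemma IsUnitaryDesign.shadowEstimator_eq {𝒰 : Measure (UGroup d)} [IsProbabilityMeasure 𝒰]
    (h𝒰 : IsUnitaryDesign 3 𝒰) {O : Matrix (Fin d) (Fin d) ℂ} (hO : O.trace = 0)
    (U : UGroup d) (s : Fin d) :
    shadowEstimator 𝒰 O (U, s) = ((d : ℝ) + 1) * (outcomeElem s O U).re := by
  have h : (O * snapshot U s).trace = outcomeElem s O U := by
    rw [snapshot, ← mul_assoc, Matrix.trace_mul_comm, ← mul_assoc, ← mul_assoc,
      Matrix.trace_mul_single]
    simp [outcomeElem]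
  rw [shadowEstimator, h𝒰.reconstructionMap_eq]
  simp only [mul_sub, mul_smul_comm, mul_one, Matrix.trace_sub, Matrix.trace_smul, hO, h,
    smul_eq_mul]
  rw [show (d : ℂ) + 1 = (((d : ℝ) + 1 : ℝ) : ℂ) by push_cast; rfl, mul_zero, sub_zero, Complex.re_ofReal_mul]

/-! ### The law of a measurement round -/

lemma bornProb_nonneg {ρ : Matrix (Fin d) (Fin d) ℂ} (hρ : IsDensity ρ) (U : UGroup d)
    (s : Fin d) : 0 ≤ bornProb ρ U s :=
  (Complex.nonneg_iff.mp ((hρ.posSemidef.mul_mul_conjTranspose_same U.1).diag_nonneg (i := s))).1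

lemma ofReal_bornProb {ρ : Matrix (Fin d) (Fin d) ℂ} (hρ : IsDensity ρ) (U : UGroup d)
    (s : Fin d) : (bornProb ρ U s : ℂ) = outcomeElem s ρ U :=
  ofReal_re_outcomeElem s hρ.posSemidef.isHermitian U

@[fun_prop]
lemma continuous_bornProb (ρ : Matrix (Fin d) (Fin d) ℂ) (s : Fin d) :
    Continuous fun U => bornProb ρ U s :=
  Complex.continuous_re.comp (continuous_outcomeElem s ρ)

lemma sum_bornProb {ρ : Matrix (Fin d) (Fin d) ℂ} (hρ : IsDensity ρ) (U : UGroup d) :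
    ∑ s, bornProb ρ U s = 1 := by
  have h := sum_outcomeElem ρ U
  simp_rw [← ofReal_bornProb hρ, hρ.trace_eq_one] at h
  exact_mod_cast h

lemma measurable_prodMk_outcome (s : Fin d) : Measurable fun U : UGroup d => (U, s) := by
  fun_prop

lemma isProbabilityMeasure_roundLaw (𝒰 : Measure (UGroup d)) [IsProbabilityMeasure 𝒰]
    {ρ : Matrix (Fin d) (Fin d) ℂ} (hρ : IsDensity ρ) :
    IsProbabilityMeasure (roundLaw 𝒰 ρ) := by
  constructor
  have h (s : Fin d) : ((𝒰.withDensity fun U => ENNReal.ofReal (bornProb ρ U s)).map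
      fun U => (U, s)) Set.univ = ∫⁻ U, ENNReal.ofReal (bornProb ρ U s) ∂𝒰 := by
    rw [Measure.map_apply (measurable_prodMk_outcome s) .univ, Set.preimage_univ,
      withDensity_apply _ .univ, setLIntegral_univ]
  rw [roundLaw, Measure.finsetSum_apply, Finset.sum_congr rfl fun s _ => h s,
    ← lintegral_finsetSum _ fun s _ => (continuous_bornProb ρ s).measurable.ennreal_ofReal]
  simp_rw [← ENNReal.ofReal_sum_of_nonneg fun s _ => bornProb_nonneg hρ _ s, sum_bornProb hρ]
  simp

/-- `f` is bounded: the group is compact and there are finitely many outcomes. -/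
lemma memLp_roundLaw (𝒰 : Measure (UGroup d)) [IsProbabilityMeasure 𝒰]
    {ρ : Matrix (Fin d) (Fin d) ℂ} (hρ : IsDensity ρ) {f : UGroup d × Fin d → ℝ}
    (hf : ∀ s, Continuous fun U => f (U, s)) (p : ENNReal) : MemLp f p (roundLaw 𝒰 ρ) := by
  have := isProbabilityMeasure_roundLaw 𝒰 hρ
  have hmeas : Measurable f := measurable_from_prod_countable_left fun s => (hf s).measurable
  choose C hC using fun s => isCompact_univ.exists_bound_of_continuousOn (hf s).continuousOn
  refine MemLp.of_bound hmeas.aestronglyMeasurable (∑ s, |C s|) (.of_forall fun x => ?_)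
  calc ‖f x‖ ≤ C x.2 := hC x.2 x.1 trivial
    _ ≤ |C x.2| := le_abs_self _
    _ ≤ ∑ s, |C s| := Finset.single_le_sum (f := fun s => |C s|) (fun s _ => abs_nonneg _)
        (Finset.mem_univ x.2)

lemma integral_roundLaw (𝒰 : Measure (UGroup d)) [IsProbabilityMeasure 𝒰]
    {ρ : Matrix (Fin d) (Fin d) ℂ} (hρ : IsDensity ρ) {f : UGroup d × Fin d → ℝ}
    (hf : ∀ s, Continuous fun U => f (U, s)) :
    ∫ x, f x ∂(roundLaw 𝒰 ρ) = ∑ s, ∫ U, bornProb ρ U s * f (U, s) ∂𝒰 := by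
  have hint : Integrable f (roundLaw 𝒰 ρ) := memLp_one_iff_integrable.mp (memLp_roundLaw 𝒰 hρ hf 1)
  have hmeas : Measurable f := measurable_from_prod_countable_left fun s => (hf s).measurable
  rw [roundLaw, integral_finsetSum_measure]
  · refine Finset.sum_congr rfl fun s _ => ?_
    rw [integral_map (measurable_prodMk_outcome s).aemeasurable hmeas.aestronglyMeasurable,
      integral_withDensity_eq_integral_toReal_smul
        (continuous_bornProb ρ s).measurable.ennreal_ofReal (by simp)]
    simp [ENNReal.toReal_ofReal (bornProb_nonneg hρ _ s)]
  · intro s _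
    refine hint.mono_measure ?_
    rw [roundLaw]
    exact Finset.single_le_sum (f := fun s =>
      (𝒰.withDensity fun U => ENNReal.ofReal (bornProb ρ U s)).map fun U => (U, s))
      (fun _ _ => Measure.zero_le _) (Finset.mem_univ s)

/-! ### The variance -/

lemma IsUnitaryDesign.shadowVariance_eq {𝒰 : Measure (UGroup d)} [IsProbabilityMeasure 𝒰]
    (h𝒰 : IsUnitaryDesign 3 𝒰) {O ρ : Matrix (Fin d) (Fin d) ℂ} (hO : O.IsHermitian)
    (hO_trace : O.trace = 0) (hρ : IsDensity ρ) :
    (shadowVariance 𝒰 O ρ : ℂ) =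
      ((d : ℂ) + 1) / ((d : ℂ) + 2) * ((O ^ 2).trace + 2 * (ρ * O ^ 2).trace)
        - (ρ * O).trace ^ 2 := by
  have := isProbabilityMeasure_roundLaw 𝒰 hρ
  -- In dimension zero every trace vanishes, contradicting `tr ρ = 1`.
  have hd : (d : ℂ) ≠ 0 := by
    rcases Nat.eq_zero_or_pos d with rfl | h
    · simpa [Matrix.trace] using hρ.trace_eq_one
    · exact_mod_cast h.ne'
  have hd2 : (d : ℂ) + 1 ≠ 0 := by exact_mod_cast (Nat.succ_ne_zero d)
  have hd3 : (d : ℂ) + 2 ≠ 0 := by exact_mod_cast (Nat.succ_ne_zero (d + 1))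
  have hcont (s : Fin d) : Continuous fun U => shadowEstimator 𝒰 O (U, s) := by
    simp_rw [h𝒰.shadowEstimator_eq hO_trace]
    fun_prop
  have hval (U : UGroup d) (s : Fin d) :
      (shadowEstimator 𝒰 O (U, s) : ℂ) = ((d : ℂ) + 1) * outcomeElem s O U := by
    rw [h𝒰.shadowEstimator_eq hO_trace]
    push_cast
    rw [ofReal_re_outcomeElem s hO]
  have hmean : ((∫ x, shadowEstimator 𝒰 O x ∂(roundLaw 𝒰 ρ) : ℝ) : ℂ) = (ρ * O).trace := by
    rw [integral_roundLaw 𝒰 hρ hcont]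
    push_cast
    simp_rw [← integral_complex_ofReal, Complex.ofReal_mul, hval, ofReal_bornProb hρ,
      mul_left_comm _ ((d : ℂ) + 1), integral_const_mul, h𝒰.integral_outcomeElem_mul]
    simp only [hO_trace, mul_zero, zero_add, Finset.sum_const, Finset.card_univ, Fintype.card_fin,
      nsmul_eq_mul]
    field_simp
  have hsq : ((∫ x, shadowEstimator 𝒰 O x ^ 2 ∂(roundLaw 𝒰 ρ) : ℝ) : ℂ) =
      ((d : ℂ) + 1) / ((d : ℂ) + 2) * ((O ^ 2).trace + 2 * (ρ * O ^ 2).trace) := by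
    rw [integral_roundLaw 𝒰 hρ (f := fun x => shadowEstimator 𝒰 O x ^ 2)
      fun s => (hcont s).pow 2]
    push_cast
    have h (s : Fin d) (U : UGroup d) :
        ((bornProb ρ U s * shadowEstimator 𝒰 O (U, s) ^ 2 : ℝ) : ℂ) =
        ((d : ℂ) + 1) ^ 2 * (outcomeElem s O U * outcomeElem s O U * outcomeElem s ρ U) := by
      push_cast
      rw [hval, ofReal_bornProb hρ]
      ring
    simp_rw [← integral_complex_ofReal, h, integral_const_mul, h𝒰.integral_outcomeElem,
      integral_outcomeElem_sq _ hO]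
    -- Only `tr(O²) tr ρ` and `2 tr(O²ρ)` survive `tr O = 0`; the `d` equal outcomes give the
    -- prefactor `d(d + 1)² / (d(d + 1)(d + 2))`.
    simp only [twirlForm, hO_trace, hρ.trace_eq_one, Finset.sum_const, Finset.card_univ,
      Fintype.card_fin, nsmul_eq_mul]
    rw [Matrix.trace_mul_comm (O * O) ρ, ← pow_two O]
    field_simp
    ring
  rw [shadowVariance, ProbabilityTheory.variance_eq_sub (memLp_roundLaw 𝒰 hρ hcont 2)]
  push_cast
  rw [← hsq, ← hmean]
  simp

/-! ### The trace inequality -/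

/-- If every `pᵢ ≤ 1/2` the bound holds term by term. Otherwise a single `p k = 1 - q` exceeds
`1/2`, and the square of the mean compensates for that index. -/
lemma two_mul_sum_mul_sq_le {ι : Type*} [Fintype ι] [DecidableEq ι] {p : ι → ℝ}
    (hp : ∀ i, 0 ≤ p i) (hp1 : ∑ i, p i = 1) (x : ι → ℝ) :
    2 * ∑ i, p i * x i ^ 2 ≤ ∑ i, x i ^ 2 + (∑ i, p i * x i) ^ 2 := by
  by_cases h : ∀ i, p i ≤ 1 / 2
  · have : 2 * ∑ i, p i * x i ^ 2 ≤ ∑ i, x i ^ 2 := by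
      rw [Finset.mul_sum]
      exact Finset.sum_le_sum fun i _ => by nlinarith [h i, sq_nonneg (x i)]
    nlinarith [sq_nonneg (∑ i, p i * x i)]
  push Not at h
  obtain ⟨k, hk⟩ := h
  set S := Finset.univ.erase k
  have split (f : ι → ℝ) : ∑ i, f i = f k + ∑ i ∈ S, f i :=
    (Finset.add_sum_erase _ f (Finset.mem_univ k)).symm
  rw [split] at hp1
  rw [split, split, split]
  set q := ∑ i ∈ S, p i with hq
  set t := ∑ i ∈ S, p i * x i with ht
  have hq0 : 0 ≤ q := Finset.sum_nonneg fun i _ => hp i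
  have hpq : ∀ i ∈ S, p i ≤ q := fun i hi => Finset.single_le_sum (fun i _ => hp i) hi
  have hpk : p k = 1 - q := by linarith
  have hrest : 2 * ∑ i ∈ S, p i * x i ^ 2 ≤ 2 * q * ∑ i ∈ S, x i ^ 2 := by
    rw [Finset.mul_sum, Finset.mul_sum]
    exact Finset.sum_le_sum fun i hi => by nlinarith [hpq i hi, sq_nonneg (x i)]
  have hcs : t ^ 2 ≤ q ^ 2 * ∑ i ∈ S, x i ^ 2 := by
    refine (Finset.sum_mul_sq_le_sq_mul_sq S p x).trans ?_
    refine mul_le_mul_of_nonneg_right ?_ (Finset.sum_nonneg fun i _ => sq_nonneg _)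
    calc ∑ i ∈ S, p i ^ 2 ≤ ∑ i ∈ S, q * p i :=
          Finset.sum_le_sum fun i hi => by nlinarith [hpq i hi, hp i]
      _ = q ^ 2 := by rw [← Finset.mul_sum, ← hq, sq]
  set R := ∑ i ∈ S, x i ^ 2
  set W := ∑ i ∈ S, p i * x i ^ 2
  rw [hpk]
  have hR : 0 ≤ R := Finset.sum_nonneg fun i _ => sq_nonneg _
  -- This is right side minus left side after `W ≤ q R`. Times `q²` it equals `(q² x k + (1 - q) t)²
  -- + (1 - 2q)(q² R - t²)`, nonnegative by `hcs` and `q < 1/2`; `q = 0` is treated apart because it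
  -- forces `t = 0`.
  have hkey : 0 ≤ q ^ 2 * x k ^ 2 + 2 * (1 - q) * x k * t + t ^ 2 + (1 - 2 * q) * R := by
    rcases hq0.eq_or_lt with h0 | h0
    · have : t = 0 := by
        have : t ^ 2 ≤ 0 := by simpa [← h0] using hcs
        exact pow_eq_zero_iff two_ne_zero |>.mp (le_antisymm this (sq_nonneg t))
      rw [this, ← h0]
      simpa using hR
    · have h2 : 0 ≤ (1 - 2 * q) * (q ^ 2 * R - t ^ 2) :=
        mul_nonneg (by linarith) (by linarith)
      refine nonneg_of_mul_nonneg_right (a := q ^ 2) ?_ (by positivity)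
      nlinarith [sq_nonneg (q ^ 2 * x k + (1 - q) * t)]
  nlinarith

/-- In an eigenbasis of `Q` only the diagonal of `ρ` enters, and it is a probability vector. -/
lemma IsDensity.two_mul_trace_mul_sq_le {ρ Q : Matrix (Fin d) (Fin d) ℂ} (hρ : IsDensity ρ)
    (hQ : Q.IsHermitian) :
    2 * (ρ * Q ^ 2).trace.re ≤ (Q ^ 2).trace.re + (ρ * Q).trace.re ^ 2 := by
  obtain ⟨V, x, rfl⟩ := exists_unitary_diagonal hQ
  set D : Matrix (Fin d) (Fin d) ℂ := Matrix.diagonal fun i => (x i : ℂ)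
  have hV : V.1ᴴ * V.1 = 1 := Matrix.mem_unitaryGroup_iff'.mp V.2
  have hV' : V.1 * V.1ᴴ = 1 := Matrix.mem_unitaryGroup_iff.mp V.2
  set σ := V.1ᴴ * ρ * V.1 with hσ
  have hσ_pos : σ.PosSemidef := hρ.posSemidef.conjTranspose_mul_mul_same V.1
  have hσ_trace : σ.trace = 1 := by
    rw [hσ, Matrix.trace_mul_comm, ← mul_assoc, hV', one_mul, hρ.trace_eq_one]
  have hsq : (V.1 * D * V.1ᴴ) ^ 2 = V.1 * D ^ 2 * V.1ᴴ := by
    calc (V.1 * D * V.1ᴴ) ^ 2 = V.1 * D * (V.1ᴴ * V.1) * D * V.1ᴴ := by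
          simp only [sq, mul_assoc]
      _ = _ := by rw [hV, mul_one, mul_assoc V.1 D D, sq]
  have htr (X : Matrix (Fin d) (Fin d) ℂ) : (ρ * (V.1 * X * V.1ᴴ)).trace = (σ * X).trace := by
    rw [← mul_assoc, ← mul_assoc, Matrix.trace_mul_comm, hσ]
    simp only [mul_assoc]
  have htr' (X : Matrix (Fin d) (Fin d) ℂ) : (V.1 * X * V.1ᴴ).trace = X.trace := by
    rw [Matrix.trace_mul_comm, ← mul_assoc, hV, one_mul]
  have hdiag (i : Fin d) : ((σ i i).re : ℂ) = σ i i := hσ_pos.isHermitian.coe_re_apply_self i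
  have key := two_mul_sum_mul_sq_le (p := fun i => (σ i i).re)
    (fun i => (Complex.nonneg_iff.mp (hσ_pos.diag_nonneg (i := i))).1)
    (by simpa [Matrix.trace] using congrArg Complex.re hσ_trace) x
  rw [hsq, htr, htr, htr', sq D, Matrix.diagonal_mul_diagonal]
  have e1 : (σ * Matrix.diagonal fun i => (x i : ℂ) * (x i : ℂ)).trace.re =
      ∑ i, (σ i i).re * x i ^ 2 := by
    simp [Matrix.trace, Matrix.mul_diagonal, sq]
  have e2 : (Matrix.diagonal fun i => (x i : ℂ) * (x i : ℂ)).trace.re = ∑ i, x i ^ 2 := by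
    simp [Matrix.trace, sq]
  have e3 : (σ * D).trace.re = ∑ i, (σ i i).re * x i := by
    simp [D, Matrix.trace, Matrix.mul_diagonal]
  rw [e1, e2, e3]
  exact key

lemma trace_mul_re {A B : Matrix (Fin d) (Fin d) ℂ} (hA : A.IsHermitian) (hB : B.IsHermitian) :
    ((A * B).trace.re : ℂ) = (A * B).trace := by
  refine Complex.conj_eq_iff_re.mp ?_
  rw [starRingEnd_apply, ← Matrix.trace_conjTranspose, Matrix.conjTranspose_mul, hA.eq, hB.eq,
    Matrix.trace_mul_comm]

lemma IsUnitaryDesign.shadowVariance_le {𝒰 : Measure (UGroup d)} [IsProbabilityMeasure 𝒰]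
    (h𝒰 : IsUnitaryDesign 3 𝒰) {O ρ : Matrix (Fin d) (Fin d) ℂ} (hO : O.IsHermitian)
    (hO_trace : O.trace = 0) (hρ : IsDensity ρ) :
    shadowVariance 𝒰 O ρ ≤ 2 * schattenTwoNorm O ^ 2 := by
  have hvar := h𝒰.shadowVariance_eq hO hO_trace hρ
  have hO2 : (O ^ 2).IsHermitian := hO.pow 2
  rw [← trace_mul_re hρ.posSemidef.isHermitian hO2, ← trace_mul_re hρ.posSemidef.isHermitian hO,
    sq O, ← trace_mul_re hO hO, ← sq O] at hvar
  have hineq := hρ.two_mul_trace_mul_sq_le hO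
  have hnonneg : 0 ≤ (Oᴴ * O).trace.re :=
    (Complex.nonneg_iff.mp (Matrix.posSemidef_conjTranspose_mul_self O).trace_nonneg).1
  rw [schattenTwoNorm, Real.sq_sqrt hnonneg, hO.eq, ← sq O]
  rw [hO.eq, ← sq O] at hnonneg
  have hvar' : shadowVariance 𝒰 O ρ = ((d : ℝ) + 1) / ((d : ℝ) + 2) *
      ((O ^ 2).trace.re + 2 * (ρ * O ^ 2).trace.re) - (ρ * O).trace.re ^ 2 := by
    apply Complex.ofReal_injective
    rw [hvar]
    push_cast
    rfl
  rw [hvar']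
  set c := ((d : ℝ) + 1) / ((d : ℝ) + 2)
  have hc0 : 0 ≤ c := by positivity
  have hc1 : c ≤ 1 := (div_le_one (by positivity)).mpr (by linarith)
  -- With `T = tr(O²)` and `m = tr(ρO)`, the trace inequality bounds the variance by `c(2T + m²) -
  -- m²`, and `c ≤ 1` gives `2T`.
  nlinarith [mul_le_mul_of_nonneg_left hineq hc0, mul_le_mul_of_nonneg_right hc1 hnonneg,
    mul_le_mul_of_nonneg_right hc1 (sq_nonneg (ρ * O).trace.re)]

end ShadowEstimation

end

theorem proposition1 {d : ℕ} (𝒰 : MeasureTheory.Measure (ShadowEstimation.UGroup d))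
    [MeasureTheory.IsProbabilityMeasure 𝒰]
    (h𝒰 : ShadowEstimation.IsUnitaryDesign 3 𝒰)
    (O ρ : Matrix (Fin d) (Fin d) ℂ) (hO : O.IsHermitian) (hO_trace : O.trace = 0)
    (hρ : ShadowEstimation.IsDensity ρ) :
    Function.Bijective (ShadowEstimation.measurementChannel 𝒰) ∧
    ((ShadowEstimation.shadowVariance 𝒰 O ρ : ℝ) : ℂ) =
      ((d : ℂ) + 1) / ((d : ℂ) + 2) * ((O ^ 2).trace + 2 * (ρ * O ^ 2).trace)
        - (ρ * O).trace ^ 2 ∧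
    ShadowEstimation.shadowVariance 𝒰 O ρ ≤ 2 * ShadowEstimation.schattenTwoNorm O ^ 2 ∧
    (∀ Q : Matrix (Fin d) (Fin d) ℂ, Q.IsHermitian →
      2 * (ρ * Q ^ 2).trace.re ≤ (Q ^ 2).trace.re + (ρ * Q).trace.re ^ 2) := by
  exact ⟨h𝒰.bijective_measurementChannel, h𝒰.shadowVariance_eq hO hO_trace hρ,
    h𝒰.shadowVariance_le hO hO_trace hρ, fun _ hQ => hρ.two_mul_trace_mul_sq_le hQ⟩
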